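/- For a finite abelian group $G$, a subgroup class of $G$ is an isomorphism class of groups that contains a subgroup of $G$ (so isomorphic subgroups of $G$ are counted only once). For $n\ge 1$ let $A(n)$ be the total number of subgroup classes of abelian groups of order $n$, that is, $$A(n)=\sum_{G}\#\{\text{isomorphism classes of subgroups of } G\},$$ where $G$ runs over the abelian groups of order $n$ (of arbitrary rank), one from each isomorphism class. Then there is an absolute constant $C>0$ such that $$\sum_{n\le x}A(n)\sim C\,x\log x\qquad (x\to\infty).$$ -/

import Mathlib

open Filter Asymptotics

/-- A finite abelian group `G` of order `n` together with a subgroup `H` of `G`. -/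
structure AbelianSubgroupPair (n : ℕ) where
  G : Type
  [addCommGroup : AddCommGroup G]
  [finite : Finite G]
  card_eq : Nat.card G = n
  H : AddSubgroup G

attribute [instance] AbelianSubgroupPair.addCommGroup AbelianSubgroupPair.finite

/-- The groups `G` are taken up to isomorphism, and within each `G` isomorphic subgroups are
counted only once: `(G, H)` and `(G', H')` are identified if and only if `G ≃ G'` and `H ≃ H'`
as abstract groups (no compatibility between the two isomorphisms is required). -/
instance AbelianSubgroupPair.setoid (n : ℕ) : Setoid (AbelianSubgroupPair n) where
  r P Q := Nonempty (P.G ≃+ Q.G) ∧ Nonempty (P.H ≃+ Q.H)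
  iseqv :=
    { refl := fun P => ⟨⟨AddEquiv.refl P.G⟩, ⟨AddEquiv.refl P.H⟩⟩
      symm := fun ⟨⟨e⟩, ⟨f⟩⟩ => ⟨⟨e.symm⟩, ⟨f.symm⟩⟩
      trans := fun ⟨⟨e⟩, ⟨f⟩⟩ ⟨⟨e'⟩, ⟨f'⟩⟩ => ⟨⟨e.trans e'⟩, ⟨f.trans f'⟩⟩ }

/-- The subgroup classes of abelian groups of order `n`. -/
abbrev AbelianSubgroupClass (n : ℕ) : Type 1 := Quotient (AbelianSubgroupPair.setoid n)

/-- There are finitely many subgroup classes of abelian groups of order `n`, so that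
their number `Nat.card (AbelianSubgroupClass n)` is a genuine count. -/
instance AbelianSubgroupClass.finite (n : ℕ) : Finite (AbelianSubgroupClass n) := by
  -- every class is represented by a group structure on one fixed set of cardinality `n`
  obtain ⟨α, _, hc⟩ : ∃ α : Type, Finite α ∧ Nat.card α = n := ⟨Fin n, inferInstance, by simp⟩
  have hA : Finite (AddCommGroup α) :=
    Finite.of_injective (fun (a : AddCommGroup α) => a.toAdd.add) (by
      intro a b h
      apply AddCommGroup.ext
      ext x y
      exact congrFun (congrFun h x) y)
  have hS : ∀ a : AddCommGroup α, Finite (@AddSubgroup α a.toAddGroup) :=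
    fun a => inferInstance
  refine Finite.of_surjective
    (fun t : (Σ a : AddCommGroup α, @AddSubgroup α a.toAddGroup) =>
      (Quotient.mk (AbelianSubgroupPair.setoid n)
        (@AbelianSubgroupPair.mk n α t.1 _ hc t.2))) ?_
  intro q
  induction q using Quotient.inductionOn with
  | h P =>
    obtain ⟨e⟩ : Nonempty (α ≃ P.G) := Finite.card_eq.1 (hc.trans P.card_eq.symm)
    let inst : AddCommGroup α := e.addCommGroup
    let f : α ≃+ P.G := e.addEquiv
    refine ⟨⟨inst, P.H.comap f.toAddMonoidHom⟩, Quotient.sound ⟨⟨f⟩, ⟨?_⟩⟩⟩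
    exact
      { toFun := fun x => ⟨f x.1, x.2⟩
        invFun := fun y => ⟨f.symm y.1, by
          change f (f.symm y.1) ∈ P.H
          simp⟩
        left_inv := fun x => Subtype.ext (f.symm_apply_apply x.1)
        right_inv := fun y => Subtype.ext (f.apply_symm_apply y.1)
        map_add' := fun x y => Subtype.ext (map_add f x.1 y.1) }

/-- `A(n)`: the number of subgroup classes of abelian groups of order `n`, i.e. the sum, over the
abelian groups `G` of order `n` up to isomorphism, of the number of isomorphism classes of
subgroups of `G`. -/
noncomputable def subgroupClassCount (n : ℕ) : ℕ := Nat.card (AbelianSubgroupClass n)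

/-! A finite abelian group splits along coprime factors of its order, and so do its subgroups, so
`A` is multiplicative. Also `A(p) = 2 = d(p)`, with `d` the divisor function. Hence `A = h * d` for
the Dirichlet convolution `h = A * μ * μ`, which vanishes at primes.

A class at `p ^ k` is determined by two partitions, the types of the group and of the subgroup, so
`A(p ^ k)` is `O((16/9) ^ k)` uniformly in `p`, and `h(p ^ k)` obeys a similar bound. Since `16/9 <
2`, the local series of `|h n| / n` converge even at `p = 2`. As they have no term at `p`, each is
`1 + O(1/p ^ 2)`, and `∑ |h n| / n` converges.

With `D(y) = ∑_{n ≤ y} d(n) ~ y log y`, the sum of `A` up to `x` is `∑ h(m) D(x/m)`. Dominated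
convergence gives the limit `C = ∑ h(m)/m` after division by `x log x`. Since `A ≥ d` pointwise, `C
≥ 1`. -/

/-! ### Coprime splitting and multiplicativity -/

theorem eq_zero_of_coprime_nsmul {C : Type*} [AddCommGroup C] {m n : ℕ} (h : m.Coprime n) {c : C}
    (h1 : m • c = 0) (h2 : n • c = 0) : c = 0 := by
  have h3 : addOrderOf c ∣ Nat.gcd m n :=
    Nat.dvd_gcd (addOrderOf_dvd_of_nsmul_eq_zero h1) (addOrderOf_dvd_of_nsmul_eq_zero h2)
  rw [h.gcd_eq_one, Nat.dvd_one] at h3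
  exact AddMonoid.addOrderOf_eq_one_iff.1 h3

/-- The second component of `e (a, 0)` is killed by both `m` and `n`, hence is zero. The same holds
for `e.symm`, so both maps restrict to the first factors. -/
theorem addEquiv_of_prod_addEquiv_prod {A B A' B' : Type*} [AddCommGroup A] [AddCommGroup B]
    [AddCommGroup A'] [AddCommGroup B'] {m n : ℕ} (h : m.Coprime n)
    (hA : ∀ a : A, m • a = 0) (hA' : ∀ a : A', m • a = 0)
    (hB : ∀ b : B, n • b = 0) (hB' : ∀ b : B', n • b = 0) (e : A × B ≃+ A' × B') :
    Nonempty (A ≃+ A') := by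
  have h1 : ∀ a : A, (e (a, 0)).2 = 0 := fun a => by
    refine eq_zero_of_coprime_nsmul h ?_ (hB' _)
    rw [← Prod.smul_snd, ← map_nsmul, Prod.smul_mk, hA, smul_zero, Prod.mk_zero_zero, map_zero]
    rfl
  have h2 : ∀ a : A', (e.symm (a, 0)).2 = 0 := fun a => by
    refine eq_zero_of_coprime_nsmul h ?_ (hB _)
    rw [← Prod.smul_snd, ← map_nsmul, Prod.smul_mk, hA', smul_zero, Prod.mk_zero_zero, map_zero]
    rfl
  refine ⟨{ toFun := fun a => (e (a, 0)).1
            invFun := fun a => (e.symm (a, 0)).1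
            left_inv := fun a => ?_
            right_inv := fun a => ?_
            map_add' := fun a b => ?_ }⟩
  · have : ((e (a, 0)).1, (0 : B')) = e (a, 0) := Prod.ext rfl (h1 a).symm
    simp [this]
  · have : ((e.symm (a, 0)).1, (0 : B)) = e.symm (a, 0) := Prod.ext rfl (h2 a).symm
    simp [this]
  · rw [← Prod.fst_add, ← map_add]
    simp

theorem nsmul_eq_zero_of_card_eq {G : Type*} [AddCommGroup G] {n : ℕ}
    (h : Nat.card G = n) (a : G) : n • a = 0 := by
  rw [← h]; exact card_nsmul_eq_zero'

theorem coprime_card_of_nsmul_eq_zero {A : Type*} [AddCommGroup A] [Finite A] {m n : ℕ}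
    (h : m.Coprime n) (hA : ∀ a : A, m • a = 0) : (Nat.card A).Coprime n := by
  refine Nat.Coprime.symm (Nat.coprime_of_dvd fun q hq hqn hqA => ?_)
  have := Fact.mk hq
  obtain ⟨a, ha⟩ := exists_prime_addOrderOf_dvd_card' q hqA
  have := addOrderOf_dvd_of_nsmul_eq_zero (hA a)
  rw [ha] at this
  exact hq.one_lt.ne' (Nat.eq_one_of_dvd_coprimes h this hqn)

namespace AbelianSubgroupPair

/-- The direct product of two groups with subgroups. -/
def prod {m n : ℕ} (P : AbelianSubgroupPair m) (Q : AbelianSubgroupPair n) :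
    AbelianSubgroupPair (m * n) where
  G := P.G × Q.G
  card_eq := by rw [Nat.card_prod, P.card_eq, Q.card_eq]
  H := P.H.prod Q.H

theorem nsmul_coe_eq_zero {n : ℕ} (P : AbelianSubgroupPair n) (a : P.H) : n • a = 0 :=
  Subtype.ext (nsmul_eq_zero_of_card_eq P.card_eq a.1)

theorem prod_equiv_prod {m n : ℕ} {P P' : AbelianSubgroupPair m} {Q Q' : AbelianSubgroupPair n}
    (hP : P ≈ P') (hQ : Q ≈ Q') : P.prod Q ≈ P'.prod Q' := by
  obtain ⟨⟨e⟩, ⟨f⟩⟩ := hP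
  obtain ⟨⟨e'⟩, ⟨f'⟩⟩ := hQ
  exact ⟨⟨AddEquiv.prodCongr e e'⟩, ⟨(AddSubgroup.prodEquiv _ _).trans
    ((AddEquiv.prodCongr f f').trans (AddSubgroup.prodEquiv _ _).symm)⟩⟩

theorem equiv_of_prod_equiv_prod {m n : ℕ} (h : m.Coprime n) {P P' : AbelianSubgroupPair m}
    {Q Q' : AbelianSubgroupPair n} (hPQ : P.prod Q ≈ P'.prod Q') : P ≈ P' ∧ Q ≈ Q' := by
  obtain ⟨⟨e⟩, ⟨f⟩⟩ := hPQ
  have e' : P.G × Q.G ≃+ P'.G × Q'.G := e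
  have f' : P.H × Q.H ≃+ P'.H × Q'.H :=
    (AddSubgroup.prodEquiv _ _).symm.trans (f.trans (AddSubgroup.prodEquiv _ _))
  have hG {k : ℕ} (R : AbelianSubgroupPair k) : ∀ a : R.G, k • a = 0 :=
    nsmul_eq_zero_of_card_eq R.card_eq
  refine ⟨⟨?_, ?_⟩, ⟨?_, ?_⟩⟩
  · exact addEquiv_of_prod_addEquiv_prod h (hG _) (hG _) (hG _) (hG _) e'
  · exact addEquiv_of_prod_addEquiv_prod h P.nsmul_coe_eq_zero P'.nsmul_coe_eq_zero
      Q.nsmul_coe_eq_zero Q'.nsmul_coe_eq_zero f'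
  · exact addEquiv_of_prod_addEquiv_prod h.symm (hG _) (hG _) (hG _) (hG _)
      (AddEquiv.prodComm.trans (e'.trans AddEquiv.prodComm))
  · exact addEquiv_of_prod_addEquiv_prod h.symm Q.nsmul_coe_eq_zero Q'.nsmul_coe_eq_zero
      P.nsmul_coe_eq_zero P'.nsmul_coe_eq_zero
      (AddEquiv.prodComm.trans (f'.trans AddEquiv.prodComm))

/-- The factors are the `m`-torsion and the `n`-torsion. The Bézout splitting `g = (v * n) • g + (u
* m) • g` uses only integer multiples of `g`, so it stays inside `H` and splits `H` as well. -/
theorem exists_prod_equiv {m n : ℕ} (h : m.Coprime n) (R : AbelianSubgroupPair (m * n)) :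
    ∃ (P : AbelianSubgroupPair m) (Q : AbelianSubgroupPair n), P.prod Q ≈ R := by
  obtain ⟨G, hcard, H⟩ := R
  set A : AddSubgroup G := (nsmulAddMonoidHom (α := G) m).ker with hA
  set B : AddSubgroup G := (nsmulAddMonoidHom (α := G) n).ker with hB
  have memA : ∀ a, a ∈ A ↔ m • a = 0 := fun a => by simp [hA, AddMonoidHom.mem_ker]
  have memB : ∀ a, a ∈ B ↔ n • a = 0 := fun a => by simp [hB, AddMonoidHom.mem_ker]
  obtain ⟨u, v, huv⟩ := Nat.isCoprime_iff_coprime.2 h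
  have hz : ∀ g : G, ((m : ℤ) * n) • g = 0 := fun g => by
    exact_mod_cast nsmul_eq_zero_of_card_eq hcard g
  have hgA : ∀ g : G, (v * n) • g ∈ A := fun g => by
    rw [memA, ← natCast_zsmul, smul_smul, show (m : ℤ) * (v * n) = v * (m * n) by ring, mul_smul,
      hz, smul_zero]
  have hgB : ∀ g : G, (u * m) • g ∈ B := fun g => by
    rw [memB, ← natCast_zsmul, smul_smul, show (n : ℤ) * (u * m) = u * (m * n) by ring, mul_smul,
      hz, smul_zero]
  have hsplit : ∀ g : G, (v * n) • g + (u * m) • g = g := fun g => by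
    rw [← add_smul, add_comm, huv, one_smul]
  let φ : A × B →+ G := A.subtype.coprod B.subtype
  have hφ : ∀ x : A × B, φ x = x.1 + x.2 := fun x => rfl
  have hinj : Function.Injective φ := by
    refine (injective_iff_map_eq_zero φ).2 ?_
    rintro ⟨⟨a, ha⟩, ⟨b, hb⟩⟩ hab
    rw [hφ] at hab
    have hab : a + b = 0 := hab
    rw [memA] at ha
    rw [memB] at hb
    have hb' : m • b = 0 := by
      have := congrArg (m • ·) hab
      simpa [ha] using this
    have ha' : n • a = 0 := by
      have := congrArg (n • ·) hab
      simpa [hb] using this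
    have e1 := eq_zero_of_coprime_nsmul h ha ha'
    have e2 := eq_zero_of_coprime_nsmul h hb' hb
    subst e1 e2
    rfl
  have hsurj : Function.Surjective φ := fun g =>
    ⟨(⟨_, hgA g⟩, ⟨_, hgB g⟩), hsplit g⟩
  let e : A × B ≃+ G := AddEquiv.ofBijective φ ⟨hinj, hsurj⟩
  have hprod : Nat.card A * Nat.card B = m * n := by
    rw [← Nat.card_prod, Nat.card_congr e.toEquiv, hcard]
  have hmn : 0 < m * n := by rw [← hcard]; exact Nat.card_pos
  have dA : Nat.card A ∣ m := by
    have : (Nat.card A).Coprime n :=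
      coprime_card_of_nsmul_eq_zero h fun a => Subtype.ext ((memA _).1 a.2)
    exact this.dvd_of_dvd_mul_right (hprod ▸ dvd_mul_right _ _)
  have dB : Nat.card B ∣ n := by
    have : (Nat.card B).Coprime m :=
      coprime_card_of_nsmul_eq_zero h.symm fun a => Subtype.ext ((memB _).1 a.2)
    exact this.dvd_of_dvd_mul_left (hprod ▸ dvd_mul_left _ _)
  have hm : 0 < m := Nat.pos_of_mul_pos_right hmn
  have hn : 0 < n := Nat.pos_of_mul_pos_left hmn
  have lA := Nat.le_of_dvd hm dA
  have lB := Nat.le_of_dvd hn dB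
  -- Neither order exceeds its bound and the products agree, so both bounds are attained.
  have cA : Nat.card A = m := by nlinarith
  have cB : Nat.card B = n := by nlinarith
  refine ⟨⟨A, cA, H.comap A.subtype⟩, ⟨B, cB, H.comap B.subtype⟩, ⟨e⟩, ?_⟩
  have hmap : ((H.comap A.subtype).prod (H.comap B.subtype)).map (e : A × B →+ G) = H := by
    ext g
    constructor
    · rintro ⟨⟨a, b⟩, ⟨ha, hb⟩, rfl⟩
      exact H.add_mem ha hb
    · intro hg
      exact ⟨(⟨_, hgA g⟩, ⟨_, hgB g⟩), ⟨H.zsmul_mem hg _, H.zsmul_mem hg _⟩, hsplit g⟩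
  exact ⟨(e.addSubgroupMap _).trans (AddEquiv.addSubgroupCongr hmap)⟩

end AbelianSubgroupPair

theorem subgroupClassCount_mul {m n : ℕ} (h : m.Coprime n) :
    subgroupClassCount (m * n) = subgroupClassCount m * subgroupClassCount n := by
  unfold subgroupClassCount
  rw [← Nat.card_prod]
  symm
  refine Nat.card_eq_of_bijective (fun x : AbelianSubgroupClass m × AbelianSubgroupClass n =>
    Quotient.map₂ AbelianSubgroupPair.prod
      (fun _ _ h1 _ _ h2 => AbelianSubgroupPair.prod_equiv_prod h1 h2) x.1 x.2) ⟨?_, ?_⟩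
  · rintro ⟨p, q⟩ ⟨p', q'⟩
    induction p, q using Quotient.inductionOn₂ with | _ P Q
    induction p', q' using Quotient.inductionOn₂ with | _ P' Q'
    intro hpq
    obtain ⟨h1, h2⟩ := AbelianSubgroupPair.equiv_of_prod_equiv_prod h (Quotient.exact hpq)
    exact Prod.ext (Quotient.sound h1) (Quotient.sound h2)
  · intro r
    induction r using Quotient.inductionOn with | _ R
    obtain ⟨P, Q, hPQ⟩ := AbelianSubgroupPair.exists_prod_equiv h R
    exact ⟨(⟦P⟧, ⟦Q⟧), Quotient.sound hPQ⟩

/-! ### Values at 0, 1 and primes, and the divisor lower bound -/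

theorem subgroupClassCount_zero : subgroupClassCount 0 = 0 := by
  have : IsEmpty (AbelianSubgroupClass 0) :=
    ⟨fun q => Quotient.inductionOn q fun P => Nat.card_pos.ne' P.card_eq⟩
  exact Nat.card_of_isEmpty

/-- The order of the subgroup is an invariant of a subgroup class. -/
noncomputable def AbelianSubgroupClass.subgroupCard {n : ℕ} (q : AbelianSubgroupClass n) : ℕ :=
  Quotient.lift (fun P => Nat.card P.H) (fun _ _ h => by
    obtain ⟨_, ⟨f⟩⟩ := h
    exact Nat.card_congr f.toEquiv) q

/-- Cyclic groups already give one subgroup class for every divisor. -/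
theorem card_divisors_le_subgroupClassCount (n : ℕ) :
    n.divisors.card ≤ subgroupClassCount n := by
  rcases eq_or_ne n 0 with rfl | hn
  · simp
  have := NeZero.mk hn
  let F : n.divisors → AbelianSubgroupClass n := fun d =>
    ⟦⟨ZMod n, Nat.card_zmod n, AddSubgroup.zmultiples ((n / d.1 : ℕ) : ZMod n)⟩⟧
  have hF : ∀ d, (F d).subgroupCard = d.1 := by
    rintro ⟨d, hd⟩
    have hdn := Nat.dvd_of_mem_divisors hd
    change Nat.card (AddSubgroup.zmultiples ((n / d : ℕ) : ZMod n)) = d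
    rw [Nat.card_zmultiples, ZMod.addOrderOf_coe _ hn, Nat.gcd_eq_right (Nat.div_dvd_of_dvd hdn),
      Nat.div_div_self hdn hn]
  have hinj : Function.Injective F := fun a b hab => Subtype.ext (by rw [← hF a, hab, hF b])
  have := Nat.card_le_card_of_injective F hinj
  rwa [Nat.card_eq_fintype_card, Fintype.card_coe] at this

/-- Multiplicativity makes the value idempotent, and the divisor bound makes it positive. -/
theorem subgroupClassCount_one : subgroupClassCount 1 = 1 := by
  have h1 := subgroupClassCount_mul (Nat.coprime_one_left 1)
  have h2 := card_divisors_le_subgroupClassCount 1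
  simp only [Nat.divisors_one, Finset.card_singleton, mul_one] at h1 h2
  exact Nat.eq_of_mul_eq_mul_left h2 (by omega)

/-- A group of prime order is unique up to isomorphism and its subgroups are trivial or everything,
so the order of the subgroup determines the class. The lower bound comes from the two divisors. -/
theorem subgroupClassCount_prime {p : ℕ} (hp : p.Prime) : subgroupClassCount p = 2 := by
  have := Fact.mk hp
  apply le_antisymm
  · have hmem : ∀ q : AbelianSubgroupClass p, q.subgroupCard ∈ p.divisors := fun q =>
      Quotient.inductionOn q fun P => Nat.mem_divisors.2
        ⟨(AddSubgroup.card_addSubgroup_dvd_card P.H).trans P.card_eq.dvd, hp.ne_zero⟩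
    have hinj : Function.Injective
        (fun q : AbelianSubgroupClass p => (⟨q.subgroupCard, hmem q⟩ : p.divisors)) := by
      intro q q' h
      induction q, q' using Quotient.inductionOn₂ with | _ P Q
      have hc : Nat.card P.H = Nat.card Q.H := congrArg Subtype.val h
      have hdvd : Nat.card P.H ∣ p := Nat.dvd_of_mem_divisors (hmem ⟦P⟧)
      refine Quotient.sound ⟨⟨addEquivOfPrimeCardEq P.card_eq Q.card_eq⟩, ?_⟩
      rcases (Nat.dvd_prime hp).1 hdvd with h1 | h1
      · have := (Nat.card_eq_one_iff_unique.1 h1).1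
        have := (Nat.card_eq_one_iff_unique.1 (hc ▸ h1)).1
        exact ⟨{ (0 : P.H →+ Q.H) with
          invFun := fun _ => 0
          left_inv := fun _ => Subsingleton.elim _ _
          right_inv := fun _ => Subsingleton.elim _ _ }⟩
      · exact ⟨addEquivOfPrimeCardEq h1 (hc ▸ h1)⟩
    have := Nat.card_le_card_of_injective _ hinj
    rwa [Nat.card_eq_fintype_card (α := p.divisors), Fintype.card_coe, hp.divisors,
      Finset.card_pair hp.one_lt.ne] at this
  · simpa [hp.divisors, Finset.card_pair hp.one_lt.ne] using card_divisors_le_subgroupClassCount p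

/-! ### Prime powers and partitions -/

/-- The multiplicity functions of the partitions of `k`: the part `c + 1` occurs `m c` times. -/
def partitionMultiplicities (k : ℕ) : Finset (Fin k → ℕ) :=
  (Fintype.piFinset fun _ => Finset.range (k + 1)).filter fun m => ∑ c, (c.1 + 1) * m c = k

theorem exists_addEquiv_pi_zmod {G : Type*} [AddCommGroup G] [Finite G] {p k : ℕ} (hp : p.Prime)
    (hG : Nat.card G = p ^ k) :
    ∃ m ∈ partitionMultiplicities k,
      Nonempty (G ≃+ ((x : Σ c : Fin k, Fin (m c)) → ZMod (p ^ (x.1.1 + 1)))) := by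
  classical
  obtain ⟨ι, _, n, hn, ⟨e⟩⟩ := AddCommGroup.equiv_directSum_zmod_of_finite' G
  have e1 : G ≃+ ((i : ι) → ZMod (n i)) := e.trans (DirectSum.addEquivProd _)
  have hprod : ∏ i, n i = p ^ k := by
    rw [← hG, Nat.card_congr e1.toEquiv, Nat.card_pi]
    simp
  have hf : ∀ i, ∃ j : Fin k, n i = p ^ (j.1 + 1) := fun i => by
    obtain ⟨j, hj, hj'⟩ := (Nat.dvd_prime_pow hp).1
      (hprod ▸ Finset.dvd_prod_of_mem n (Finset.mem_univ i) : n i ∣ p ^ k)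
    -- The cyclic factors are nontrivial, so every exponent is at least 1 and can be indexed by `j -
    -- 1`.
    have h0 : j ≠ 0 := by
      rintro rfl
      have := hn i
      simp_all
    exact ⟨⟨j - 1, by omega⟩, by rw [hj']; congr 1; simp; omega⟩
  choose g hg using hf
  obtain rfl : n = fun i => p ^ ((g i).1 + 1) := funext hg
  let m : Fin k → ℕ := fun c => Fintype.card {i // g i = c}
  have hsum : ∑ c, (c.1 + 1) * m c = k := by
    have h1 : ∑ i, ((g i).1 + 1) = k :=
      Nat.pow_right_injective hp.two_le (by simpa [Finset.prod_pow_eq_pow_sum] using hprod)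
    refine Eq.trans ?_ h1
    rw [← Finset.sum_fiberwise' (s := Finset.univ) (g := g) (f := fun c => c.1 + 1)]
    refine Finset.sum_congr rfl fun c _ => ?_
    simp [m, Fintype.card_subtype, mul_comm]
  refine ⟨m, ?_, ⟨?_⟩⟩
  · simp only [partitionMultiplicities, Finset.mem_filter, Fintype.mem_piFinset, Finset.mem_range]
    refine ⟨fun c => Nat.lt_succ_of_le ?_, hsum⟩
    calc m c ≤ (c.1 + 1) * m c := Nat.le_mul_of_pos_left _ (Nat.succ_pos _)
      _ ≤ ∑ c, (c.1 + 1) * m c :=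
        Finset.single_le_sum (f := fun c : Fin k => (c.1 + 1) * m c) (by simp) (Finset.mem_univ c)
      _ = k := hsum
  · let E : ι ≃ Σ c : Fin k, Fin (m c) :=
      (Equiv.sigmaFiberEquiv g).symm.trans (Equiv.sigmaCongrRight fun c => Fintype.equivFin _)
    exact e1.trans (RingEquiv.piCongrLeft
      (fun x : Σ c : Fin k, Fin (m c) => ZMod (p ^ (x.1.1 + 1))) E).toAddEquiv

theorem sum_pow_succ_le (k : ℕ) : ∑ c : Fin k, ((3 / 4 : ℝ)) ^ (c.1 + 1) ≤ 3 := by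
  rw [Fin.sum_univ_eq_sum_range (fun c => (3 / 4 : ℝ) ^ (c + 1)) k]
  simp_rw [pow_succ]
  rw [← Finset.sum_mul, geom_sum_eq (by norm_num)]
  have : (0 : ℝ) ≤ (3 / 4) ^ k := by positivity
  norm_num
  linarith

/-- Rankin's trick: each partition of `k` gets weight `(3/4) ^ k`, a product over its parts.
Dropping the condition on the sum leaves a product of truncated geometric series, bounded
independently of `k`. The base `4/3` serves because its square is below 2. -/
theorem card_partitionMultiplicities_le (k : ℕ) :
    ((partitionMultiplicities k).card : ℝ) ≤ Real.exp 12 * (4 / 3) ^ k := by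
  have hx : ∀ c : ℕ, ∑ j ∈ Finset.range (k + 1), ((3 / 4 : ℝ) ^ (c + 1)) ^ j
      ≤ Real.exp (4 * (3 / 4) ^ (c + 1)) := by
    intro c
    set y : ℝ := (3 / 4) ^ (c + 1) with hy
    have y0 : 0 < y := by positivity
    have y1 : y ≤ 3 / 4 := by
      rw [hy]
      exact pow_le_of_le_one (by norm_num) (by norm_num) (by omega)
    rw [geom_sum_eq (by linarith)]
    -- This rests on `(1 + 4y)(1 - y) ≥ 1`, which holds for `0 ≤ y ≤ 3/4`.
    have : (y ^ (k + 1) - 1) / (y - 1) ≤ 4 * y + 1 := by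
      rw [div_le_iff_of_neg (by linarith)]
      have : 0 < y ^ (k + 1) := by positivity
      nlinarith
    exact this.trans (Real.add_one_le_exp _)
  have h1 : ((partitionMultiplicities k).card : ℝ) * (3 / 4) ^ k ≤ Real.exp 12 := by
    calc ((partitionMultiplicities k).card : ℝ) * (3 / 4) ^ k
        = ∑ m ∈ partitionMultiplicities k, ∏ c : Fin k, ((3 / 4 : ℝ) ^ (c.1 + 1)) ^ m c := by
          rw [← nsmul_eq_mul, ← Finset.sum_const]
          refine Finset.sum_congr rfl fun m hm => ?_
          simp_rw [← pow_mul]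
          rw [Finset.prod_pow_eq_pow_sum, (Finset.mem_filter.1 hm).2]
      _ ≤ ∑ m ∈ Fintype.piFinset fun _ : Fin k => Finset.range (k + 1),
            ∏ c : Fin k, ((3 / 4 : ℝ) ^ (c.1 + 1)) ^ m c :=
          Finset.sum_le_sum_of_subset_of_nonneg (Finset.filter_subset _ _)
            fun _ _ _ => Finset.prod_nonneg fun _ _ => by positivity
      _ = ∏ c : Fin k, ∑ j ∈ Finset.range (k + 1), ((3 / 4 : ℝ) ^ (c.1 + 1)) ^ j :=
          (Finset.prod_univ_sum (fun _ : Fin k => Finset.range (k + 1))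
            fun c j => ((3 / 4 : ℝ) ^ (c.1 + 1)) ^ j).symm
      _ ≤ ∏ c : Fin k, Real.exp (4 * (3 / 4) ^ (c.1 + 1)) :=
          Finset.prod_le_prod (fun _ _ => by positivity) fun c _ => hx c.1
      _ = Real.exp (4 * ∑ c : Fin k, (3 / 4 : ℝ) ^ (c.1 + 1)) := by
          rw [← Real.exp_sum, Finset.mul_sum]
      _ ≤ Real.exp 12 := Real.exp_le_exp.2 (by linarith [sum_pow_succ_le k])
  have h2 : (3 / 4 : ℝ) ^ k * (4 / 3) ^ k = 1 := by rw [← mul_pow]; norm_num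
  calc ((partitionMultiplicities k).card : ℝ)
      = (partitionMultiplicities k).card * (3 / 4) ^ k * (4 / 3) ^ k := by rw [mul_assoc, h2, mul_one]
    _ ≤ _ := by gcongr

theorem subgroupClassCount_prime_pow_le_card {p : ℕ} (hp : p.Prime) (k : ℕ) :
    subgroupClassCount (p ^ k) ≤ (partitionMultiplicities k).card *
      ∑ j ∈ Finset.range (k + 1), (partitionMultiplicities j).card := by
  have hH : ∀ P : AbelianSubgroupPair (p ^ k), ∃ j : Fin (k + 1), Nat.card P.H = p ^ j.1 :=
    fun P => by
      obtain ⟨j, hj, h⟩ := (Nat.dvd_prime_pow hp).1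
        ((AddSubgroup.card_addSubgroup_dvd_card P.H).trans P.card_eq.dvd)
      exact ⟨⟨j, by omega⟩, h⟩
  choose j hj using hH
  choose m hm eG using fun P : AbelianSubgroupPair (p ^ k) => exists_addEquiv_pi_zmod hp P.card_eq
  choose m' hm' eH using fun P : AbelianSubgroupPair (p ^ k) => exists_addEquiv_pi_zmod hp (hj P)
  let F : AbelianSubgroupPair (p ^ k) →
      partitionMultiplicities k × Σ j : Fin (k + 1), partitionMultiplicities j.1 :=
    fun P => (⟨m P, hm P⟩, ⟨j P, ⟨m' P, hm' P⟩⟩)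
  have hF : ∀ P Q, F P = F Q → P ≈ Q := by
    intro P Q h
    have h1 : m P = m Q := congrArg (fun x => x.1.1) h
    -- The order of the subgroup varies with the class, so exponent and multiplicities are compared
    -- together in a sigma type.
    have h2 : (⟨(j P).1, m' P⟩ : Σ j : ℕ, Fin j → ℕ) = ⟨(j Q).1, m' Q⟩ :=
      congrArg (fun x => (⟨x.2.1.1, x.2.2.1⟩ : Σ j : ℕ, Fin j → ℕ)) h
    have key : ∀ x y : Σ j : ℕ, Fin j → ℕ, x = y →
        Nonempty (((z : Σ c : Fin x.1, Fin (x.2 c)) → ZMod (p ^ (z.1.1 + 1))) ≃+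
          ((z : Σ c : Fin y.1, Fin (y.2 c)) → ZMod (p ^ (z.1.1 + 1)))) := by
      rintro x _ rfl
      exact ⟨AddEquiv.refl _⟩
    refine ⟨⟨(eG P).some.trans ((key ⟨k, m P⟩ ⟨k, m Q⟩ (by rw [h1])).some.trans
      (eG Q).some.symm)⟩, ⟨(eH P).some.trans ((key _ _ h2).some.trans (eH Q).some.symm)⟩⟩
  have hinj : Function.Injective fun q : AbelianSubgroupClass (p ^ k) => F q.out := fun q q' h => by
    rw [← q.out_eq, ← q'.out_eq]
    exact Quotient.sound (hF _ _ h)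
  have := Nat.card_le_card_of_injective _ hinj
  rw [Finset.sum_range]
  simpa [subgroupClassCount, Nat.card_prod, Nat.card_sigma] using this

theorem subgroupClassCount_prime_pow_le {p : ℕ} (hp : p.Prime) (k : ℕ) :
    (subgroupClassCount (p ^ k) : ℝ) ≤ 4 * Real.exp 12 ^ 2 * (16 / 9) ^ k := by
  have h1 : (subgroupClassCount (p ^ k) : ℝ) ≤ (partitionMultiplicities k).card *
      ∑ j ∈ Finset.range (k + 1), ((partitionMultiplicities j).card : ℝ) := by
    exact_mod_cast subgroupClassCount_prime_pow_le_card hp k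
  have h2 : ∑ j ∈ Finset.range (k + 1), ((partitionMultiplicities j).card : ℝ)
      ≤ Real.exp 12 * (4 * (4 / 3) ^ k) := by
    calc _ ≤ ∑ j ∈ Finset.range (k + 1), Real.exp 12 * (4 / 3 : ℝ) ^ j :=
          Finset.sum_le_sum fun j _ => card_partitionMultiplicities_le j
      _ ≤ _ := by
          rw [← Finset.mul_sum, geom_sum_eq (by norm_num), pow_succ]
          gcongr
          rw [div_le_iff₀ (by norm_num)]
          linarith
  calc _ ≤ _ := h1
    _ ≤ (Real.exp 12 * (4 / 3) ^ k) * (Real.exp 12 * (4 * (4 / 3) ^ k)) :=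
        mul_le_mul (card_partitionMultiplicities_le k) h2 (by positivity) (by positivity)
    _ = _ := by
        rw [show (16 / 9 : ℝ) = 4 / 3 * (4 / 3) by norm_num, mul_pow]
        ring

/-! ### Convolution with μ and absolute convergence -/

open ArithmeticFunction in
theorem ArithmeticFunction.mul_moebius_prime_pow_succ (f : ArithmeticFunction ℝ) {p : ℕ}
    (hp : p.Prime) (k : ℕ) :
    (f * ((moebius : ArithmeticFunction ℤ) : ArithmeticFunction ℝ)) (p ^ (k + 1)) =
      f (p ^ (k + 1)) - f (p ^ k) := by
  set g := f * ((moebius : ArithmeticFunction ℤ) : ArithmeticFunction ℝ) with hg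
  have hf : g * ((zeta : ArithmeticFunction ℕ) : ArithmeticFunction ℝ) = f := by
    rw [hg, mul_assoc, coe_moebius_mul_coe_zeta, mul_one]
  have key : ∀ k, f (p ^ k) = ∑ i ∈ Finset.range (k + 1), g (p ^ i) := fun k => by
    conv_lhs => rw [← hf]
    rw [coe_mul_zeta_apply, Nat.sum_divisors_prime_pow hp]
  rw [key, key, Finset.sum_range_succ _ (k + 1)]
  ring

/-- A finite partial sum is at most the Euler product over the primes below some `N`, which is at
most `exp (M ∑ 1/n ^ 2)` because `1 + t ≤ exp t`. -/
theorem summable_of_multiplicative_of_prime_pow {g : ℕ → ℝ} (g0 : g 0 = 0) (g1 : g 1 = 1)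
    (gmul : ∀ {m n : ℕ}, m.Coprime n → g (m * n) = g m * g n) (gnn : ∀ n, 0 ≤ g n) {M : ℝ}
    (hsum : ∀ {p : ℕ}, p.Prime → Summable fun k : ℕ => g (p ^ k))
    (hle : ∀ {p : ℕ}, p.Prime → ∑' k : ℕ, g (p ^ k) ≤ 1 + M * (1 / (p : ℝ) ^ 2)) (hM : 0 ≤ M) :
    Summable g := by
  have hS : Summable fun n : ℕ => 1 / (n : ℝ) ^ 2 := Real.summable_one_div_nat_pow.2 (by norm_num)
  refine summable_of_sum_le (c := Real.exp (M * ∑' n : ℕ, 1 / (n : ℝ) ^ 2)) gnn fun u => ?_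
  obtain ⟨N, hN⟩ : ∃ N, ∀ m ∈ u, m < N :=
    ⟨u.sup id + 1, fun m hm => Nat.lt_succ_of_le (Finset.le_sup (f := id) hm)⟩
  have hP := (EulerProduct.summable_and_hasSum_factoredNumbers_prod_filter_prime_tsum g1 gmul
    (fun hp => by simpa [abs_of_nonneg (gnn _)] using hsum hp) (Finset.range N)).2
  have hP' : HasSum ((Nat.factoredNumbers (Finset.range N)).indicator g) _ :=
    hasSum_subtype_iff_indicator.1 hP
  calc ∑ m ∈ u, g m = ∑ m ∈ u, (Nat.factoredNumbers (Finset.range N)).indicator g m := by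
        refine Finset.sum_congr rfl fun m hm => ?_
        rcases eq_or_ne m 0 with rfl | h0
        · simp [Set.indicator, g0]
        · rw [Set.indicator_of_mem]
          refine Nat.mem_factoredNumbers_of_primeFactors_subset h0 fun q hq => ?_
          exact Finset.mem_range.2 ((Nat.le_of_mem_primeFactors hq).trans_lt (hN m hm))
    _ ≤ _ := sum_le_hasSum u (fun _ _ => Set.indicator_nonneg (fun _ _ => gnn _) _) hP'
    _ ≤ ∏ p ∈ Finset.range N with p.Prime, Real.exp (M * (1 / (p : ℝ) ^ 2)) := by
        refine Finset.prod_le_prod (fun _ _ => tsum_nonneg fun _ => gnn _) fun p hp => ?_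
        refine (hle (Finset.mem_filter.1 hp).2).trans ?_
        rw [add_comm]
        exact Real.add_one_le_exp _
    _ = Real.exp (M * ∑ p ∈ Finset.range N with p.Prime, 1 / (p : ℝ) ^ 2) := by
        rw [← Real.exp_sum, Finset.mul_sum]
    _ ≤ _ := by
        gcongr
        exact hS.sum_le_tsum _ fun _ _ => by positivity

/-- As `h p = 0`, the local series is 1 plus a tail starting at `p ^ 2`. That tail is dominated by a
geometric series of ratio `(16/9)/p ≤ 8/9`, whence the factor 9 in `M`. -/
theorem summable_div_of_le_pow {h : ArithmeticFunction ℝ} (hm : h.IsMultiplicative)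
    (hprime : ∀ {p : ℕ}, p.Prime → h p = 0) {L : ℝ}
    (hpow : ∀ {p : ℕ}, p.Prime → ∀ k, |h (p ^ k)| ≤ L * (16 / 9) ^ k) :
    Summable fun n : ℕ => |h n| / n := by
  have hL : 0 ≤ L := by simpa using (abs_nonneg _).trans (hpow Nat.prime_two 0)
  have hterm : ∀ {p : ℕ}, p.Prime → ∀ k,
      |h (p ^ (k + 2))| / ((p ^ (k + 2) : ℕ) : ℝ) ≤ L * (16 / 9 / p) ^ 2 * (16 / 9 / p) ^ k := by
    intro p hp k
    have : (0 : ℝ) < p := by exact_mod_cast hp.pos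
    rw [mul_assoc, ← pow_add, add_comm 2 k, div_pow, ← mul_div_assoc, Nat.cast_pow]
    gcongr
    exact hpow hp _
  have hratio : ∀ {p : ℕ}, p.Prime → (16 / 9 / p : ℝ) ≤ 8 / 9 := by
    intro p hp
    have : (2 : ℝ) ≤ p := by exact_mod_cast hp.two_le
    rw [div_le_iff₀ (by linarith)]
    linarith
  have hgeo : ∀ {p : ℕ}, p.Prime → Summable fun k : ℕ =>
      L * (16 / 9 / (p : ℝ)) ^ 2 * (16 / 9 / p) ^ k := fun {p} hp =>
    (summable_geometric_of_lt_one (by positivity) (by linarith [hratio hp])).mul_left _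
  have hshift : ∀ {p : ℕ}, p.Prime → Summable fun k : ℕ =>
      |h (p ^ (k + 2))| / ((p ^ (k + 2) : ℕ) : ℝ) := fun hp =>
    Summable.of_nonneg_of_le (fun _ => by positivity) (hterm hp) (hgeo hp)
  have hsum : ∀ {p : ℕ}, p.Prime → Summable fun k : ℕ => |h (p ^ k)| / ((p ^ k : ℕ) : ℝ) :=
    fun {p} hp => (summable_nat_add_iff
      (f := fun k => |h (p ^ k)| / ((p ^ k : ℕ) : ℝ)) 2).1 (hshift hp)
  refine summable_of_multiplicative_of_prime_pow (M := 9 * L * (16 / 9) ^ 2) (by simp)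
    (by simp [hm.1]) (fun {m n} hmn => ?_) (fun n => by positivity) hsum (fun {p} hp => ?_)
    (by positivity)
  · rw [hm.2 hmn, abs_mul, Nat.cast_mul, mul_div_mul_comm]
  · have hp0 : (0 : ℝ) < p := by exact_mod_cast hp.pos
    rw [← (hsum hp).sum_add_tsum_nat_add 2]
    have h2 : ∑ k ∈ Finset.range 2, |h (p ^ k)| / ((p ^ k : ℕ) : ℝ) = 1 := by
      simp [Finset.sum_range_succ, hm.1, hprime hp]
    rw [h2]
    gcongr
    calc _ ≤ ∑' k : ℕ, L * (16 / 9 / (p : ℝ)) ^ 2 * (16 / 9 / p) ^ k :=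
          (hshift hp).tsum_le_tsum (hterm hp) (hgeo hp)
      _ = L * (16 / 9 / (p : ℝ)) ^ 2 * (1 - 16 / 9 / (p : ℝ))⁻¹ := by
          rw [tsum_mul_left, tsum_geometric_of_lt_one (by positivity) (by linarith [hratio hp])]
      _ ≤ L * (16 / 9 / (p : ℝ)) ^ 2 * 9 := by
          gcongr
          rw [inv_le_comm₀ (by linarith [hratio hp]) (by norm_num)]
          linarith [hratio hp]
      _ = _ := by field_simp

/-! ### The divisor summatory function -/

/-- The summatory function of the number of divisors. -/
noncomputable def divisorSummatory (y : ℝ) : ℝ := ∑ n ∈ Finset.Ioc 0 ⌊y⌋₊, (n.divisors.card : ℝ)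

open ArithmeticFunction in
theorem zeta_mul_zeta_apply (n : ℕ) :
    (((zeta : ArithmeticFunction ℕ) : ArithmeticFunction ℝ) * (zeta : ArithmeticFunction ℕ)) n =
      n.divisors.card := by
  rw [coe_mul_zeta_apply, Finset.card_eq_sum_ones, Nat.cast_sum]
  refine Finset.sum_congr rfl fun i hi => ?_
  simp [(Nat.pos_of_mem_divisors hi).ne']

theorem divisorSummatory_eq (y : ℝ) :
    divisorSummatory y = ∑ n ∈ Finset.Ioc 0 ⌊y⌋₊, (⌊y / n⌋₊ : ℝ) := by
  simp_rw [Nat.floor_div_natCast]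
  have := ArithmeticFunction.sum_Ioc_sigma0_eq_sum_div ⌊y⌋₊
  simp only [ArithmeticFunction.sigma_zero_apply] at this
  unfold divisorSummatory
  exact_mod_cast this

theorem divisorSummatory_nonneg (y : ℝ) : 0 ≤ divisorSummatory y :=
  Finset.sum_nonneg fun _ _ => by positivity

theorem divisorSummatory_eq_zero {y : ℝ} (hy : y < 1) : divisorSummatory y = 0 := by
  simp [divisorSummatory, Nat.floor_eq_zero.2 hy]

theorem sum_Ioc_inv_eq_harmonic (n : ℕ) :
    ∑ i ∈ Finset.Ioc 0 n, ((i : ℝ))⁻¹ = (harmonic n : ℝ) := by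
  rw [harmonic_eq_sum_Icc]
  push_cast
  rfl

theorem divisorSummatory_le {y : ℝ} (hy : 1 ≤ y) :
    divisorSummatory y ≤ y * (1 + Real.log y) := by
  rw [divisorSummatory_eq]
  calc _ ≤ ∑ n ∈ Finset.Ioc 0 ⌊y⌋₊, y * (n : ℝ)⁻¹ :=
        Finset.sum_le_sum fun n _ => by
          rw [← div_eq_mul_inv]
          exact Nat.floor_le (by positivity)
    _ ≤ _ := by
        rw [← Finset.mul_sum, sum_Ioc_inv_eq_harmonic]
        gcongr
        exact harmonic_floor_le_one_add_log y hy

theorem le_divisorSummatory {y : ℝ} (hy : 0 ≤ y) :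
    y * (Real.log y - 1) ≤ divisorSummatory y := by
  rw [divisorSummatory_eq]
  calc y * (Real.log y - 1) ≤ y * (harmonic ⌊y⌋₊ : ℝ) - ⌊y⌋₊ := by
        have h1 := mul_le_mul_of_nonneg_left (log_le_harmonic_floor y hy) hy
        have h2 := Nat.floor_le hy
        linarith
    _ = ∑ n ∈ Finset.Ioc 0 ⌊y⌋₊, (y * (n : ℝ)⁻¹ - 1) := by
        rw [Finset.sum_sub_distrib, ← Finset.mul_sum, sum_Ioc_inv_eq_harmonic]
        simp
    _ ≤ _ := Finset.sum_le_sum fun n _ => by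
        rw [← div_eq_mul_inv]
        exact (Nat.sub_one_lt_floor _).le

/-- Having `log x` in place of `log (x / m)` makes the bound uniform in `m`, which provides the
dominating series later. -/
theorem divisorSummatory_div_le {x : ℝ} (hx : 1 ≤ x) (m : ℕ) :
    divisorSummatory (x / m) ≤ x / m * (1 + Real.log x) := by
  have hlog := Real.log_nonneg hx
  rcases lt_or_ge (x / m) 1 with h | h
  · rw [divisorSummatory_eq_zero h]
    positivity
  · refine (divisorSummatory_le h).trans ?_
    have hm : m ≠ 0 := by
      rintro rfl
      norm_num at h
    have : (1 : ℝ) ≤ m := by exact_mod_cast Nat.one_le_iff_ne_zero.2 hm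
    gcongr
    exact div_le_self (by linarith) this

theorem tendsto_divisorSummatory_div (m : ℕ) (hm : m ≠ 0) :
    Tendsto (fun x : ℝ => divisorSummatory (x / m) / (x * Real.log x)) atTop
      (nhds (1 / (m : ℝ))) := by
  have hm0 : (0 : ℝ) < m := by exact_mod_cast Nat.pos_of_ne_zero hm
  have hinv : Tendsto (fun x : ℝ => (Real.log x)⁻¹) atTop (nhds 0) :=
    tendsto_inv_atTop_zero.comp Real.tendsto_log_atTop
  have hlim : ∀ c : ℝ, Tendsto (fun x : ℝ => 1 / (m : ℝ) * (1 + c * (Real.log x)⁻¹)) atTop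
      (nhds (1 / (m : ℝ))) := fun c => by
    simpa using ((hinv.const_mul c).const_add 1).const_mul (1 / (m : ℝ))
  refine tendsto_of_tendsto_of_tendsto_of_le_of_le' (hlim (-Real.log m - 1)) (hlim 1) ?_ ?_
  · filter_upwards [eventually_gt_atTop (1 : ℝ)] with x hx
    have hl := Real.log_pos hx
    have hx0 : 0 < x := by linarith
    rw [le_div_iff₀ (by positivity)]
    refine le_trans (le_of_eq ?_) (le_divisorSummatory (by positivity))
    rw [Real.log_div hx0.ne' hm0.ne']
    field_simp
    ring
  · filter_upwards [eventually_gt_atTop (1 : ℝ)] with x hx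
    have hl := Real.log_pos hx
    have hx0 : 0 < x := by linarith
    rw [div_le_iff₀ (by positivity)]
    refine (divisorSummatory_div_le hx.le m).trans (le_of_eq ?_)
    field_simp
    ring

/-! ### Asymptotics by dominated convergence -/

theorem tendsto_sum_mul_divisorSummatory {h : ArithmeticFunction ℝ}
    (hs : Summable fun n : ℕ => |h n| / n) :
    Tendsto (fun x : ℝ => (∑ m ∈ Finset.Ioc 0 ⌊x⌋₊, h m * divisorSummatory (x / m)) /
      (x * Real.log x)) atTop (nhds (∑' m : ℕ, h m * (1 / (m : ℝ)))) := by
  -- The sum extends to all `m` because `divisorSummatory` vanishes below 1.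
  have heq : ∀ᶠ x : ℝ in atTop, ∑' m : ℕ, h m * (divisorSummatory (x / m) / (x * Real.log x)) =
      (∑ m ∈ Finset.Ioc 0 ⌊x⌋₊, h m * divisorSummatory (x / m)) / (x * Real.log x) := by
    filter_upwards [eventually_gt_atTop (1 : ℝ)] with x hx
    rw [tsum_eq_sum (s := Finset.Ioc 0 ⌊x⌋₊), Finset.sum_div]
    · exact Finset.sum_congr rfl fun _ _ => by ring
    · intro m hm
      rcases Nat.eq_zero_or_pos m with rfl | h0
      · simp
      · have h1 : ⌊x⌋₊ < m := by
          by_contra hc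
          exact hm (Finset.mem_Ioc.2 ⟨h0, not_lt.1 hc⟩)
        have h2 : x / m < 1 := by
          rw [div_lt_one (by exact_mod_cast h0)]
          exact Nat.lt_of_floor_lt h1
        rw [divisorSummatory_eq_zero h2]
        simp
  refine Tendsto.congr' heq (tendsto_tsum_of_dominated_convergence
    (bound := fun m => |h m| / m * 2) (hs.mul_right 2) (fun m => ?_) ?_)
  · rcases eq_or_ne m 0 with rfl | h0
    · simp
    · exact (tendsto_divisorSummatory_div m h0).const_mul _
  -- For `x ≥ e`, `1 + log x ≤ 2 log x`; this is the 2 in the dominating function.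
  · filter_upwards [eventually_ge_atTop (Real.exp 1)] with x hx m
    have hx1 : 1 ≤ x := (Real.one_le_exp zero_le_one).trans hx
    have hx0 : 0 < x := by linarith
    have hl : 1 ≤ Real.log x := (Real.le_log_iff_exp_le hx0).2 hx
    rw [norm_mul, Real.norm_eq_abs, Real.norm_eq_abs,
      abs_of_nonneg (div_nonneg (divisorSummatory_nonneg _) (by positivity)), div_mul_eq_mul_div,
      mul_div_assoc]
    refine mul_le_mul_of_nonneg_left ?_ (abs_nonneg _)
    rw [div_le_iff₀ (by positivity)]
    refine (divisorSummatory_div_le hx1 m).trans ?_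
    rw [show (2 : ℝ) / m * (x * Real.log x) = x / m * (2 * Real.log x) by ring]
    gcongr
    linarith

open ArithmeticFunction in
theorem sum_isEquivalent_mul_log {f : ArithmeticFunction ℝ} (hf : f.IsMultiplicative)
    (hprime : ∀ {p : ℕ}, p.Prime → f p = 2) {L : ℝ} (hnonneg : ∀ n, 0 ≤ f n)
    (hpow : ∀ {p : ℕ}, p.Prime → ∀ k, f (p ^ k) ≤ L * (16 / 9) ^ k)
    (hdiv : ∀ n : ℕ, (n.divisors.card : ℝ) ≤ f n) :
    ∃ C : ℝ, 0 < C ∧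
      (fun x : ℝ => ∑ n ∈ Finset.Icc 1 ⌊x⌋₊, f n) ~[atTop] (fun x : ℝ => C * x * Real.log x) := by
  have hL : 0 ≤ L := by simpa using (hnonneg _).trans (hpow Nat.prime_two 0)
  set M : ArithmeticFunction ℝ := ((moebius : ArithmeticFunction ℤ) : ArithmeticFunction ℝ) with hM
  set Z : ArithmeticFunction ℝ := ((zeta : ArithmeticFunction ℕ) : ArithmeticFunction ℝ) with hZ
  have hMZ : M * Z = 1 := coe_moebius_mul_coe_zeta
  set h : ArithmeticFunction ℝ := f * M * M with hh
  have hmM : M.IsMultiplicative := isMultiplicative_moebius.intCast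
  have hm : h.IsMultiplicative := (hf.mul hmM).mul hmM
  have hfh : h * (Z * Z) = f := by
    calc h * (Z * Z) = f * (M * Z) * (M * Z) := by rw [hh]; ring
      _ = f := by rw [hMZ, mul_one, mul_one]
  -- Two differences give `h p = (f p - f 1) - 1 = 2 - 1 - 1`.
  have hp0 : ∀ {p : ℕ}, p.Prime → h p = 0 := by
    intro p hp
    have h1 := mul_moebius_prime_pow_succ (f * M) hp 0
    have h2 := mul_moebius_prime_pow_succ f hp 0
    simp only [zero_add, pow_one, pow_zero] at h1 h2
    rw [hh, h1, h2, hprime hp, hf.1, (hf.mul hmM).1]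
    norm_num
  -- A difference of two nonnegative numbers is bounded by the larger, so the constant `L` survives.
  -- The second convolution has signed terms and doubles it.
  have hb1 : ∀ {p : ℕ}, p.Prime → ∀ k, |(f * M) (p ^ k)| ≤ L * (16 / 9) ^ k := by
    intro p hp k
    rcases k with - | k
    · have := hpow hp 0
      rw [pow_zero, hf.1] at this
      rw [pow_zero, (hf.mul hmM).1]
      simpa using this
    · rw [mul_moebius_prime_pow_succ f hp, abs_le]
      have h1 := hpow hp (k + 1)
      have h2 := hpow hp k
      have h3 := hnonneg (p ^ k)
      have h4 := hnonneg (p ^ (k + 1))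
      have h5 : L * (16 / 9 : ℝ) ^ k ≤ L * (16 / 9) ^ (k + 1) := by
        gcongr <;> norm_num
      constructor <;> linarith
  have hb2 : ∀ {p : ℕ}, p.Prime → ∀ k, |h (p ^ k)| ≤ (2 * L) * (16 / 9) ^ k := by
    intro p hp k
    rcases k with - | k
    · have := hpow hp 0
      rw [pow_zero, hf.1] at this
      rw [pow_zero, hm.1]
      simp at this ⊢
      linarith
    · rw [hh, mul_moebius_prime_pow_succ (f * M) hp]
      have h1 := hb1 hp (k + 1)
      have h2 := hb1 hp k
      have h5 : L * (16 / 9 : ℝ) ^ k ≤ L * (16 / 9) ^ (k + 1) := by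
        gcongr <;> norm_num
      refine (abs_sub _ _).trans ?_
      linarith
  have hlim := tendsto_sum_mul_divisorSummatory (summable_div_of_le_pow hm hp0 hb2)
  set C := ∑' m : ℕ, h m * (1 / (m : ℝ)) with hC
  have hconv : ∀ x : ℝ, ∑ m ∈ Finset.Ioc 0 ⌊x⌋₊, h m * divisorSummatory (x / m) =
      ∑ n ∈ Finset.Icc 1 ⌊x⌋₊, f n := by
    intro x
    change _ = ∑ n ∈ Finset.Ioc 0 ⌊x⌋₊, f n
    rw [← hfh, sum_Ioc_mul_eq_sum_sum]
    refine Finset.sum_congr rfl fun m _ => ?_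
    simp_rw [divisorSummatory, Nat.floor_div_natCast, hZ, zeta_mul_zeta_apply]
  simp_rw [hconv] at hlim
  -- Comparing the sums of `f` and of the divisor function gives positivity of `C` without
  -- evaluating the series.
  have hC1 : 1 ≤ C := by
    have h1 := tendsto_divisorSummatory_div 1 one_ne_zero
    simp only [Nat.cast_one, div_one] at h1
    refine le_of_tendsto_of_tendsto h1 hlim ?_
    filter_upwards [eventually_gt_atTop (1 : ℝ)] with x hx
    have hl := Real.log_pos hx
    refine div_le_div_of_nonneg_right (Finset.sum_le_sum fun n _ => hdiv n) (by positivity)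
  refine ⟨C, by linarith, ?_⟩
  refine (isEquivalent_iff_tendsto_one ?_).2 ?_
  · filter_upwards [eventually_gt_atTop (1 : ℝ)] with x hx
    have hl := Real.log_pos hx
    have : 0 < C := by linarith
    positivity
  · have := hlim.div_const C
    rw [div_self (by linarith)] at this
    refine this.congr fun x => ?_
    simp only [Pi.div_apply]
    rw [div_div]
    congr 1
    ring

theorem corollary4 :
    ∃ C : ℝ, 0 < C ∧
      (fun x : ℝ => ((∑ n ∈ Finset.Icc 1 ⌊x⌋₊, subgroupClassCount n : ℕ) : ℝ))
        ~[atTop] (fun x : ℝ => C * x * Real.log x) := by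
  let f : ArithmeticFunction ℝ := ⟨fun n => subgroupClassCount n, by simp [subgroupClassCount_zero]⟩
  have hf : ∀ n, f n = subgroupClassCount n := fun _ => rfl
  have hmul : f.IsMultiplicative := by
    refine ⟨by simp [hf, subgroupClassCount_one], fun {m n} h => ?_⟩
    simp [hf, subgroupClassCount_mul h]
  simpa [hf] using sum_isEquivalent_mul_log hmul
    (fun hp => by simp [hf, subgroupClassCount_prime hp]) (fun n => by simp [hf])
    (fun hp k => subgroupClassCount_prime_pow_le hp k)
    (fun n => by simpa [hf] using card_divisors_le_subgroupClassCount n)
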